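/- Let $A$ and $B$ be (complex, not necessarily unital) $\mathrm{C}^\ast$-algebras. The Pedersen ideal $\mathrm{Ped}(A)$ is the complex linear span of the positive $a\in A$ that satisfy $a\le a_1+\dots+a_n$ for some $a_1,\dots,a_n\in A_+$, each admitting $e_j\in A_+$ with $e_ja_j=a_j$. It carries the locally convex direct limit topology, i.e. the finest locally convex topology making the inclusion of every $\mathrm{C}^\ast$-subalgebra $D\subseteq A$ with $D\subseteq\mathrm{Ped}(A)$ (with its norm topology) continuous. Let $T_{\mathbb R}(A)$ be the real vector space of continuous linear functionals $\tau\colon\mathrm{Ped}(A)\to\mathbb C$ with $\tau(xy)=\tau(yx)$ and $\tau(x^\ast)=\overline{\tau(x)}$ for all $x,y\in\mathrm{Ped}(A)$, equipped with the weak$^\ast$-topology and with the cone $T_+(A)$ of those $\tau$ such that $\tau(a)\ge 0$ for all $a\in\mathrm{Ped}(A)\cap A_+$. Let $T_{\mathbb R}(A)^\ast$ be the space of continuous linear functionals $T_{\mathbb R}(A)\to\mathbb R$, equipped with the compact-open topology and with the cone $T_{\mathbb R}(A)^\ast_+$ of those $f$ such that $f(\tau)\ge0$ for all $\tau\in T_+(A)$.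 Let $(T_{\mathbb R}(A)^\ast,\mathrm{c.o.})^\ast$ be the space of linear functionals on $T_{\mathbb R}(A)^\ast$ that are continuous for the compact-open topology, equipped with the weak$^\ast$-topology and with the cone of those $g$ such that $g(T_{\mathbb R}(A)^\ast_+)\subseteq[0,\infty)$. A linear map between these spaces is called positive if it maps cone into cone. 1. The canonical map $T_{\mathbb R}(A)\to(T_{\mathbb R}(A)^\ast,\mathrm{c.o.})^\ast$, $\tau\mapsto(f\mapsto f(\tau))$, is an isomorphism of ordered topological vector spaces: it is a well-defined linear homeomorphism, and $\tau\in T_+(A)$ if and only if its image is in the positive cone. 2. Taking duals, $\gamma\mapsto\gamma^\ast$ with $\gamma^\ast(f)=f\circ\gamma$, is a bijection from the continuous linear maps $T_{\mathbb R}(B)\to T_{\mathbb R}(A)$ onto the continuous linear maps $T_{\mathbb R}(A)^\ast\to T_{\mathbb R}(B)^\ast$, and it restricts to a bijection from the continuous positive linear maps $T_{\mathbb R}(B)\to T_{\mathbb R}(A)$ onto the continuous positive linear maps $T_{\mathbb R}(A)^\ast\to T_{\mathbb R}(B)^\ast$. -/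

import Mathlib

open scoped CompactConvergenceCLM ComplexOrder Topology

/-! ### The Pedersen ideal -/

section PedersenAlgebra

variable (A : Type*) [NonUnitalCStarAlgebra A] [PartialOrder A] [StarOrderedRing A]

/-- The positive elements `a` of `A` for which there is a positive `e` with `e * a = a`. -/
def pedersenZero : Set A := {a | 0 ≤ a ∧ ∃ e : A, 0 ≤ e ∧ e * a = a}

/-- The hereditary cone generated by `pedersenZero A`: the positive elements dominated by a finite
sum of elements of `pedersenZero A`. -/
def pedersenCone : Set A :=
  {a | 0 ≤ a ∧ ∃ l : List A, (∀ b ∈ l, b ∈ pedersenZero A) ∧ a ≤ l.sum}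

/-- The Pedersen ideal of `A`, as a complex subspace of `A`: the linear span of the cone
`pedersenCone A`. -/
def pedersenSubmodule : Submodule ℂ A := Submodule.span ℂ (pedersenCone A)

variable {A}

theorem pedersenCone_add {a b : A} (ha : a ∈ pedersenCone A) (hb : b ∈ pedersenCone A) :
    a + b ∈ pedersenCone A := by
  obtain ⟨ha0, l, hl, hal⟩ := ha
  obtain ⟨hb0, m, hm, hbm⟩ := hb
  refine ⟨add_nonneg ha0 hb0, l ++ m, ?_, ?_⟩
  · intro x hx
    rcases List.mem_append.1 hx with h | h
    · exact hl x h
    · exact hm x h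
  · rw [List.sum_append]
    exact add_le_add hal hbm

/-- The Pedersen ideal is closed under the involution. -/
theorem star_mem_pedersenSubmodule {x : A} (hx : x ∈ pedersenSubmodule A) :
    star x ∈ pedersenSubmodule A := by
  refine Submodule.span_induction (p := fun y _ => star y ∈ pedersenSubmodule A) ?_ ?_ ?_ ?_ hx
  · intro a ha
    have h : star a = a := (IsSelfAdjoint.of_nonneg ha.1).star_eq
    rw [h]
    exact Submodule.subset_span ha
  · simp
  · intro y z _ _ hy hz
    rw [star_add]
    exact Submodule.add_mem _ hy hz
  · intro c y _ hy
    rw [star_smul]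
    exact Submodule.smul_mem _ _ hy

/-- Conjugation of `a : A` by an element `u` of the unitization of `A`, landing in `A`. -/
def unitizationConj (u : Unitization ℂ A) (a : A) : A :=
  star u.fst • (u.fst • a + a * u.snd) + star u.snd * (u.fst • a + a * u.snd)

theorem inr_unitizationConj (u : Unitization ℂ A) (a : A) :
    ((unitizationConj u a : A) : Unitization ℂ A) = star u * (a : Unitization ℂ A) * u := by
  ext
  · simp
  · simp [unitizationConj, mul_add, mul_assoc, mul_smul_comm]

theorem unitizationConj_mul {u : Unitization ℂ A} (hu : u ∈ unitary (Unitization ℂ A)) (a b : A) :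
    unitizationConj u a * unitizationConj u b = unitizationConj u (a * b) := by
  apply Unitization.inr_injective (R := ℂ)
  rw [Unitization.inr_mul, inr_unitizationConj, inr_unitizationConj, inr_unitizationConj,
    Unitization.inr_mul]
  have h : u * star u = 1 := (Unitary.mem_iff.1 hu).2
  calc star u * (a : Unitization ℂ A) * u * (star u * b * u)
      = star u * (a : Unitization ℂ A) * (u * star u) * b * u := by simp only [mul_assoc]
    _ = star u * ((a : Unitization ℂ A) * b) * u := by rw [h]; simp only [mul_assoc, one_mul]

theorem unitizationConj_add (u : Unitization ℂ A) (a b : A) :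
    unitizationConj u (a + b) = unitizationConj u a + unitizationConj u b := by
  apply Unitization.inr_injective (R := ℂ)
  simp only [Unitization.inr_add, inr_unitizationConj, mul_add, add_mul]

theorem unitizationConj_star_mul_self (u : Unitization ℂ A) (s : A) :
    unitizationConj u (star s * s) =
      star (u.fst • s + s * u.snd) * (u.fst • s + s * u.snd) := by
  apply Unitization.inr_injective (R := ℂ)
  have h : ((u.fst • s + s * u.snd : A) : Unitization ℂ A) = (s : Unitization ℂ A) * u := by
    ext <;> simp
  rw [inr_unitizationConj, Unitization.inr_mul, Unitization.inr_mul, Unitization.inr_star,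
    Unitization.inr_star, h, star_mul]
  simp only [mul_assoc]

theorem unitizationConj_nonneg (u : Unitization ℂ A) {a : A} (ha : 0 ≤ a) :
    0 ≤ unitizationConj u a := by
  obtain ⟨s, rfl⟩ := CStarAlgebra.nonneg_iff_eq_star_mul_self.1 ha
  rw [unitizationConj_star_mul_self]
  exact star_mul_self_nonneg _

theorem unitizationConj_mono (u : Unitization ℂ A) {a b : A} (hab : a ≤ b) :
    unitizationConj u a ≤ unitizationConj u b := by
  have h := unitizationConj_nonneg u (sub_nonneg.2 hab)
  have h2 := unitizationConj_add u (b - a) a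
  rw [sub_add_cancel] at h2
  rw [h2]
  exact le_add_of_nonneg_left h

theorem unitizationConj_mem {u : Unitization ℂ A} (hu : u ∈ unitary (Unitization ℂ A)) {a : A}
    (ha : a ∈ pedersenCone A) : unitizationConj u a ∈ pedersenCone A := by
  obtain ⟨ha0, l, hl, hal⟩ := ha
  refine ⟨unitizationConj_nonneg u ha0, l.map (unitizationConj u), ?_, ?_⟩
  · intro b hb
    obtain ⟨c, hc, rfl⟩ := List.mem_map.1 hb
    obtain ⟨hc0, e, he0, hec⟩ := hl c hc
    refine ⟨unitizationConj_nonneg u hc0, unitizationConj u e, unitizationConj_nonneg u he0, ?_⟩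
    rw [unitizationConj_mul hu, hec]
  · refine (unitizationConj_mono u hal).trans (le_of_eq ?_)
    clear hal hl
    induction l with
    | nil => simp [unitizationConj]
    | cons b l ih => simp [unitizationConj_add, ih]

theorem star_add_mul_add_mem {s t : A} (hs : star s * s ∈ pedersenCone A)
    (ht : star t * t ∈ pedersenCone A) (c : ℂ) (hc : star c * c = 1) :
    star (t + c • s) * (t + c • s) ∈ pedersenSubmodule A := by
  apply Submodule.subset_span
  obtain ⟨_, l, hl, hle⟩ := pedersenCone_add (pedersenCone_add ht hs) (pedersenCone_add ht hs)
  refine ⟨star_mul_self_nonneg _, l, hl, le_trans ?_ hle⟩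
  rw [← sub_nonneg]
  have h : star t * t + star s * s + (star t * t + star s * s) - star (t + c • s) * (t + c • s)
      = star (t - c • s) * (t - c • s) := by
    simp only [star_add, star_sub, star_smul, add_mul, mul_add, sub_mul, mul_sub,
      smul_mul_assoc, mul_smul_comm]
    match_scalars <;> first | ring1 | linear_combination (-2 : ℂ) * hc
  rw [h]
  exact star_mul_self_nonneg _

theorem star_mul_mem_of_mem {s t : A} (hs : star s * s ∈ pedersenCone A)
    (ht : star t * t ∈ pedersenCone A) : star s * t ∈ pedersenSubmodule A := by
  have h1 := star_add_mul_add_mem hs ht 1 (by simp)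
  have h2 := star_add_mul_add_mem hs ht (-1) (by simp)
  have h3 := star_add_mul_add_mem hs ht Complex.I (by simp)
  have h4 := star_add_mul_add_mem hs ht (-Complex.I) (by simp)
  have h := Submodule.smul_mem _ (1 / 4 : ℂ)
    (Submodule.add_mem _ (Submodule.sub_mem _ h1 h2)
      (Submodule.smul_mem _ Complex.I (Submodule.sub_mem _ h3 h4)))
  convert h using 1
  simp only [star_add, star_smul, add_mul, mul_add, smul_mul_assoc, mul_smul_comm, smul_smul,
    smul_add, smul_sub, star_neg, star_one, Complex.star_def, Complex.conj_I]
  match_scalars <;> ring_nf <;> norm_num [pow_succ, Complex.I_mul_I]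

/-- The Pedersen ideal is a right ideal. -/
theorem mul_mem_pedersenSubmodule_right {x : A} (hx : x ∈ pedersenSubmodule A) (y : A) :
    x * y ∈ pedersenSubmodule A := by
  refine Submodule.span_induction (p := fun x _ => x * y ∈ pedersenSubmodule A) ?_ ?_ ?_ ?_ hx
  · intro a ha
    have hy : (y : Unitization ℂ A) ∈ Submodule.span ℂ (unitary (Unitization ℂ A) : Set _) := by
      rw [CStarAlgebra.span_unitary]
      trivial
    have key : ∀ u ∈ Submodule.span ℂ (unitary (Unitization ℂ A) : Set (Unitization ℂ A)),
        u.fst • a + a * u.snd ∈ pedersenSubmodule A := by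
      intro u hu
      refine Submodule.span_induction
        (p := fun u _ => u.fst • a + a * u.snd ∈ pedersenSubmodule A) ?_ ?_ ?_ ?_ hu
      · intro u hu
        obtain ⟨s, rfl⟩ := CStarAlgebra.nonneg_iff_eq_star_mul_self.1 ha.1
        have h : u.fst • (star s * s) + star s * s * u.snd
            = star s * (u.fst • s + s * u.snd) := by
          rw [mul_add, mul_smul_comm, mul_assoc]
        rw [h]
        refine star_mul_mem_of_mem ha ?_
        rw [← unitizationConj_star_mul_self]
        exact unitizationConj_mem hu ha
      · simp
      · intro u v _ _ hu hv
        have h := Submodule.add_mem _ hu hv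
        convert h using 1
        simp only [Unitization.fst_add, Unitization.snd_add, mul_add, add_smul]
        abel
      · intro c u _ hu
        have h := Submodule.smul_mem _ c hu
        convert h using 1
        simp [smul_smul, mul_smul_comm]
    simpa using key _ hy
  · simp
  · intro a b _ _ ha hb
    rw [add_mul]
    exact Submodule.add_mem _ ha hb
  · intro c a _ ha
    rw [smul_mul_assoc]
    exact Submodule.smul_mem _ _ ha

end PedersenAlgebra

/-! ### The Pedersen ideal with its locally convex direct limit topology -/

section PedersenTopology

variable (A : Type*) [NonUnitalCStarAlgebra A] [PartialOrder A] [StarOrderedRing A]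

/-- The Pedersen ideal of `A` as a type of its own, so that it does not inherit the norm topology
of `A`. -/
def PedersenIdeal : Type _ := pedersenSubmodule A

namespace PedersenIdeal

instance : AddCommGroup (PedersenIdeal A) := inferInstanceAs (AddCommGroup (pedersenSubmodule A))

instance : Module ℂ (PedersenIdeal A) := inferInstanceAs (Module ℂ (pedersenSubmodule A))

variable {A}

/-- The inclusion of the Pedersen ideal into `A`. -/
def incl : PedersenIdeal A →ₗ[ℂ] A := (pedersenSubmodule A).subtype

instance : Mul (PedersenIdeal A) :=
  ⟨fun x y => ⟨incl x * incl y, mul_mem_pedersenSubmodule_right x.2 _⟩⟩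

instance : Star (PedersenIdeal A) :=
  ⟨fun x => ⟨star (incl x), star_mem_pedersenSubmodule x.2⟩⟩

/-- The inclusion into the Pedersen ideal of a subalgebra of `A` contained in it. -/
def ofSubalgebra (D : NonUnitalStarSubalgebra ℂ A)
    (hD : (D : Set A) ⊆ pedersenSubmodule A) (d : D) : PedersenIdeal A :=
  ⟨(d : A), hD d.2⟩

variable (A)

/-- The locally convex direct limit topology on the Pedersen ideal: the finest locally convex vector
space topology for which the inclusion of every C⋆-subalgebra `D` of `A` contained in the Pedersen
ideal is continuous, `D` carrying its norm topology. -/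
instance : TopologicalSpace (PedersenIdeal A) :=
  sInf {t : TopologicalSpace (PedersenIdeal A) |
    @IsTopologicalAddGroup (PedersenIdeal A) t _ ∧
    @ContinuousSMul ℂ (PedersenIdeal A) _ _ t ∧
    @LocallyConvexSpace ℝ (PedersenIdeal A) _ _ _ _ t ∧
    ∀ (D : NonUnitalStarSubalgebra ℂ A) (_ : IsClosed (D : Set A))
      (hD : (D : Set A) ⊆ pedersenSubmodule A), Continuous[_, t] (ofSubalgebra D hD)}

end PedersenIdeal

end PedersenTopology

/-! ### The trace space and its dual -/

section Traces

variable (A : Type*) [NonUnitalCStarAlgebra A] [PartialOrder A] [StarOrderedRing A]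

/-- The real vector space of continuous self-adjoint traces on the Pedersen ideal of `A`, with
the weak⋆ topology (the subspace topology from `WeakDual`). -/
def traceSubmodule : Submodule ℝ (WeakDual ℂ (PedersenIdeal A)) where
  carrier := {τ | (∀ x y : PedersenIdeal A, τ (x * y) = τ (y * x)) ∧
    ∀ x : PedersenIdeal A, τ (star x) = star (τ x)}
  add_mem' := by
    rintro σ τ ⟨hσ, hσ'⟩ ⟨hτ, hτ'⟩
    refine ⟨fun x y => ?_, fun x => ?_⟩
    · change σ (x * y) + τ (x * y) = σ (y * x) + τ (y * x)
      rw [hσ, hτ]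
    · change σ (star x) + τ (star x) = star (σ x + τ x)
      rw [hσ', hτ', star_add]
  zero_mem' := by
    refine ⟨fun x y => rfl, fun x => ?_⟩
    change (0 : ℂ) = star 0
    simp
  smul_mem' := by
    rintro c τ ⟨hτ, hτ'⟩
    refine ⟨fun x y => ?_, fun x => ?_⟩
    · change c • τ (x * y) = c • τ (y * x)
      rw [hτ]
    · change c • τ (star x) = star (c • τ x)
      rw [hτ']
      simp [Complex.real_smul]

/-- The trace space `T_ℝ(A)`. -/
abbrev TraceSpace : Type _ := traceSubmodule A

/-- The cone `T_+(A)` of positive traces in `T_ℝ(A)`. -/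
def traceCone : PointedCone ℝ (TraceSpace A) where
  carrier := {τ | ∀ a : PedersenIdeal A, 0 ≤ PedersenIdeal.incl a → 0 ≤ τ.1 a}
  add_mem' := by
    intro σ τ hσ hτ a ha
    change 0 ≤ σ.1 a + τ.1 a
    exact add_nonneg (hσ a ha) (hτ a ha)
  zero_mem' := by
    intro a _
    change (0 : ℂ) ≤ 0
    exact le_rfl
  smul_mem' := by
    intro c τ hτ a ha
    change 0 ≤ (c : ℝ) • τ.1 a
    exact smul_nonneg c.2 (hτ a ha)

/-- The dual trace space `T_ℝ(A)^*`: the continuous real linear functionals on `T_ℝ(A)`, with the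
compact-open topology. -/
abbrev DualTraceSpace : Type _ := TraceSpace A →L_c[ℝ] ℝ

/-- The cone in `T_ℝ(A)^*` of the functionals that are nonnegative on `T_+(A)`. -/
def dualTraceCone : PointedCone ℝ (DualTraceSpace A) where
  carrier := {f | ∀ τ ∈ traceCone A, 0 ≤ f τ}
  add_mem' := fun hf hg τ hτ => add_nonneg (hf τ hτ) (hg τ hτ)
  zero_mem' := fun _ _ => le_rfl
  smul_mem' := fun c _ hf τ hτ => mul_nonneg c.2 (hf τ hτ)

/-- The dual of `(T_ℝ(A)^*, compact-open)`: the linear functionals on `T_ℝ(A)^*` that are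
continuous for the compact-open topology, with the weak⋆ topology. -/
abbrev BidualTraceSpace : Type _ := WeakDual ℝ (DualTraceSpace A)

/-- The cone of the functionals in the bidual that are nonnegative on the cone of `T_ℝ(A)^*`. -/
def bidualTraceCone : PointedCone ℝ (BidualTraceSpace A) where
  carrier := {g | ∀ f ∈ dualTraceCone A, 0 ≤ g f}
  add_mem' := fun hf hg τ hτ => add_nonneg (hf τ hτ) (hg τ hτ)
  zero_mem' := fun _ _ => le_rfl
  smul_mem' := fun c _ hf τ hτ => mul_nonneg c.2 (hf τ hτ)

variable {A} {B : Type*} [NonUnitalCStarAlgebra B] [PartialOrder B] [StarOrderedRing B]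

/-- The dual `γ^* : T_ℝ(A)^* → T_ℝ(B)^*`, `f ↦ f ∘ γ`, of a continuous linear map
`γ : T_ℝ(B) → T_ℝ(A)`; it is continuous for the compact-open topologies. -/
noncomputable def dualMap (γ : TraceSpace B →L[ℝ] TraceSpace A) : DualTraceSpace A →L[ℝ] DualTraceSpace B :=
  γ.precompCompactConvergenceCLM ℝ

end Traces

/-! ### Continuity on the Pedersen ideal -/

namespace PedersenIdeal

variable {A : Type*} [NonUnitalCStarAlgebra A] [PartialOrder A] [StarOrderedRing A]

/-! The topology of the trace space is generated by the functionals `τ ↦ Re τ(x)`, so these exhaust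
its dual (`traceEval_surjective`). A functional `g` on that dual therefore pulls back along
`traceEval` to a real functional on the Pedersen ideal, and its complexification is the only
candidate for a trace representing `g`. The analytic point is that this candidate is continuous. By
the universal property of the direct limit topology it suffices to check each C⋆-subalgebra `D`. A
compact set of traces is pointwise bounded on `D`, hence uniformly bounded by Banach–Steinhaus, so
`traceEval` is continuous from `D` to the compact-open topology
(`continuous_traceEval_ofSubalgebra`). Positivity is tested on evaluations at positive elements
(`mem_traceCone_iff`). The claim on maps is then formal: the predual of `η` is its transpose read
through the canonical isomorphism. -/

/-- The inclusion of a C⋆-subalgebra contained in the Pedersen ideal, as a linear map. -/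
def ofSubalgebraₗ (D : NonUnitalStarSubalgebra ℂ A)
    (hD : (D : Set A) ⊆ pedersenSubmodule A) : D →ₗ[ℂ] PedersenIdeal A where
  toFun := ofSubalgebra D hD
  map_add' _ _ := rfl
  map_smul' _ _ := rfl

theorem continuous_ofSubalgebra (D : NonUnitalStarSubalgebra ℂ A) (hc : IsClosed (D : Set A))
    (hD : (D : Set A) ⊆ pedersenSubmodule A) : Continuous (ofSubalgebra D hD) :=
  continuous_sInf_rng.2 fun _ ht => ht.2.2.2 D hc hD

/-- A linear functional on the Pedersen ideal is continuous as soon as its restrictions to the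
C⋆-subalgebras contained in the Pedersen ideal are continuous. -/
theorem continuous_of_forall_subalgebra (φ : PedersenIdeal A →ₗ[ℂ] ℂ)
    (h : ∀ (D : NonUnitalStarSubalgebra ℂ A) (_ : IsClosed (D : Set A))
      (hD : (D : Set A) ⊆ pedersenSubmodule A), Continuous fun d => φ (ofSubalgebra D hD d)) :
    Continuous φ := by
  -- The topology induced by `φ` is itself one of those whose infimum defines the direct limit
  -- topology.
  refine continuous_sInf_dom
    (t₁ := {t : TopologicalSpace (PedersenIdeal A) |
      @IsTopologicalAddGroup (PedersenIdeal A) t _ ∧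
      @ContinuousSMul ℂ (PedersenIdeal A) _ _ t ∧
      @LocallyConvexSpace ℝ (PedersenIdeal A) _ _ _ _ t ∧
      ∀ (D : NonUnitalStarSubalgebra ℂ A) (_ : IsClosed (D : Set A))
        (hD : (D : Set A) ⊆ pedersenSubmodule A), Continuous[_, t] (ofSubalgebra D hD)})
    (t := TopologicalSpace.induced φ inferInstance) ?_ continuous_induced_dom
  exact ⟨topologicalAddGroup_induced φ, continuousSMul_induced φ,
    LocallyConvexSpace.induced (φ.restrictScalars ℝ),
    fun D hc hD => continuous_induced_rng.2 (h D hc hD)⟩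

theorem star_smul_eq (c : ℂ) (x : PedersenIdeal A) : star (c • x) = star c • star x :=
  Subtype.ext (star_smul c (incl x))

theorem smul_mul_eq (c : ℂ) (x y : PedersenIdeal A) : (c • x) * y = c • (x * y) :=
  Subtype.ext (smul_mul_assoc c (incl x) (incl y))

theorem mul_smul_eq (c : ℂ) (x y : PedersenIdeal A) : x * (c • y) = c • (x * y) :=
  Subtype.ext (mul_smul_comm c (incl x) (incl y))

theorem star_eq_of_nonneg {a : PedersenIdeal A} (ha : 0 ≤ incl a) : star a = a :=
  Subtype.ext (IsSelfAdjoint.of_nonneg ha).star_eq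

end PedersenIdeal

/-! ### The dual of the trace space -/

section DualTraces

open PedersenIdeal

variable {A : Type*} [NonUnitalCStarAlgebra A] [PartialOrder A] [StarOrderedRing A]

theorem continuous_trace_apply (x : PedersenIdeal A) : Continuous fun τ : TraceSpace A => τ.1 x :=
  (WeakDual.eval_continuous x).comp continuous_subtype_val

/-- The real bilinear pairing `(τ, x) ↦ Re τ(x)` between traces and the Pedersen ideal. -/
noncomputable def tracePairing : TraceSpace A →ₗ[ℝ] PedersenIdeal A →ₗ[ℝ] ℝ :=
  LinearMap.mk₂ ℝ (fun τ x => (τ.1 x).re)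
    (fun σ τ x => Complex.add_re (σ.1 x) (τ.1 x))
    (fun c τ x => Complex.smul_re c (τ.1 x))
    (fun τ x y => by rw [map_add, Complex.add_re])
    (fun c τ x => by rw [← Complex.coe_smul, map_smul, Complex.coe_smul, Complex.smul_re])

@[simp]
theorem tracePairing_apply (τ : TraceSpace A) (x : PedersenIdeal A) :
    tracePairing τ x = (τ.1 x).re := rfl

/-- Evaluation of traces at an element of the Pedersen ideal, as an element of the dual of the
trace space. -/
noncomputable def traceEval : PedersenIdeal A →ₗ[ℝ] DualTraceSpace A where
  toFun x := (⟨tracePairing.flip x, Complex.continuous_re.comp (continuous_trace_apply x)⟩ :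
    TraceSpace A →L[ℝ] ℝ)
  map_add' x y := ContinuousLinearMap.ext fun τ => map_add (tracePairing τ) x y
  map_smul' c x := ContinuousLinearMap.ext fun τ => map_smul (tracePairing τ) c x

@[simp]
theorem traceEval_apply (x : PedersenIdeal A) (τ : TraceSpace A) :
    traceEval x τ = (τ.1 x).re := rfl

theorem dualTraceSpace_ext {f g : DualTraceSpace A} (h : ∀ τ, f τ = g τ) : f = g :=
  ContinuousLinearMap.ext h

theorem traceEval_mul_comm (x y : PedersenIdeal A) : traceEval (x * y) = traceEval (y * x) :=
  dualTraceSpace_ext fun τ => by simp [τ.2.1 x y]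

theorem traceEval_star (x : PedersenIdeal A) : traceEval (star x) = traceEval x :=
  dualTraceSpace_ext fun τ => by simp [τ.2.2 x]

/-- Since `Re τ(ix) = -Im τ(x)`, real parts alone recover a trace. -/
theorem trace_apply_eq (τ : TraceSpace A) (x : PedersenIdeal A) :
    τ.1 x = (traceEval x τ : ℂ) - Complex.I * traceEval (Complex.I • x) τ := by
  apply Complex.ext <;> simp

theorem traceEval_mem_dualTraceCone {a : PedersenIdeal A} (ha : 0 ≤ incl a) :
    traceEval a ∈ dualTraceCone A :=
  fun _ hτ => (Complex.le_def.1 (hτ a ha)).1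

/-- The weak⋆ topology of the trace space is induced by the functionals `τ ↦ Re τ(x)`. -/
theorem isInducing_trace_re :
    Topology.IsInducing fun (τ : TraceSpace A) (x : PedersenIdeal A) => (τ.1 x).re := by
  refine ⟨le_antisymm (continuous_iff_le_induced.1 (continuous_pi fun x =>
    Complex.continuous_re.comp (continuous_trace_apply x))) ?_⟩
  let t : TopologicalSpace (TraceSpace A) := TopologicalSpace.induced
    (fun (τ : TraceSpace A) (x : PedersenIdeal A) => (τ.1 x).re) inferInstance
  have hre : ∀ x : PedersenIdeal A, Continuous[t, _] fun τ : TraceSpace A => traceEval x τ :=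
    continuous_pi_iff.1 (continuous_induced_dom
      (f := fun (τ : TraceSpace A) (x : PedersenIdeal A) => (τ.1 x).re))
  refine continuous_id_iff_le.1 ?_
  refine continuous_induced_rng.2 (WeakDual.continuous_of_continuous_eval fun x => ?_)
  have h : Continuous[t, _] fun τ : TraceSpace A =>
      (traceEval x τ : ℂ) - Complex.I * traceEval (Complex.I • x) τ :=
    (Complex.continuous_ofReal.comp (hre x)).sub
      (continuous_const.mul (Complex.continuous_ofReal.comp (hre _)))
  exact h.congr fun τ => (trace_apply_eq τ x).symm

/-- If the topology of `E` is induced by a linear family of functionals, then every continuous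
functional on `E` belongs to the family. -/
theorem exists_apply_eq_of_isInducing {E F : Type*} [AddCommGroup E] [Module ℝ E]
    [TopologicalSpace E] [AddCommGroup F] [Module ℝ F] (b : E →ₗ[ℝ] F →ₗ[ℝ] ℝ)
    (hb : Topology.IsInducing fun e x => b e x) (φ : E →L[ℝ] ℝ) :
    ∃ x, ∀ e, b e x = φ e := by
  have hφ : Continuous[⨅ x, TopologicalSpace.induced (b.flip x) inferInstance, _]
      φ.toLinearMap := by
    refine continuous_le_dom ?_ φ.continuous
    rw [hb.eq_induced]
    exact (induced_to_pi _).ge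
  -- A functional continuous for the weak topology of a family is a finite combination of its
  -- members; here the family is a linear range, hence its own span.
  have h := (LinearMap.mem_span_iff_continuous (f := b.flip) φ.toLinearMap).2 hφ
  rw [← LinearMap.coe_range, Submodule.span_eq] at h
  exact h.imp fun x hx e => LinearMap.congr_fun hx e

/-- Every continuous functional on the trace space is evaluation at an element of the Pedersen
ideal. -/
theorem traceEval_surjective (f : DualTraceSpace A) : ∃ x, traceEval x = f :=
  (exists_apply_eq_of_isInducing (E := TraceSpace A) tracePairing isInducing_trace_re f).imp
    fun _ hx => dualTraceSpace_ext hx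

/-! ### Uniform boundedness and the compact-open topology -/

/-- A compact set of traces is bounded on every C⋆-subalgebra contained in the Pedersen ideal, by
the uniform boundedness principle. -/
theorem exists_bound_of_isCompact {K : Set (TraceSpace A)} (hK : IsCompact K)
    (D : NonUnitalStarSubalgebra ℂ A) (hc : IsClosed (D : Set A))
    (hD : (D : Set A) ⊆ pedersenSubmodule A) :
    ∃ M : ℝ, ∀ τ ∈ K, ∀ d : D, ‖τ.1 (ofSubalgebra D hD d)‖ ≤ M * ‖d‖ := by
  have : CompleteSpace D := hc.completeSpace_coe
  let g : K → D →L[ℂ] ℂ := fun τ =>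
    ⟨(τ.1.1 : PedersenIdeal A →L[ℂ] ℂ).toLinearMap ∘ₗ ofSubalgebraₗ D hD,
      (τ.1.1 : PedersenIdeal A →L[ℂ] ℂ).continuous.comp (continuous_ofSubalgebra D hc hD)⟩
  obtain ⟨M, hM⟩ := banach_steinhaus (g := g) fun d => by
    -- Pointwise boundedness: evaluation at a fixed `d` is weak⋆ continuous, hence bounded on `K`.
    obtain ⟨C, hC⟩ := hK.exists_bound_of_continuousOn
      (continuous_trace_apply (ofSubalgebra D hD d)).continuousOn
    exact ⟨C, fun τ => hC τ.1 τ.2⟩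
  exact ⟨M, fun τ hτ d => (g ⟨τ, hτ⟩).le_of_opNorm_le (hM ⟨τ, hτ⟩) d⟩

theorem continuous_traceEval_ofSubalgebra (D : NonUnitalStarSubalgebra ℂ A)
    (hc : IsClosed (D : Set A)) (hD : (D : Set A) ⊆ pedersenSubmodule A) :
    Continuous fun d => traceEval (ofSubalgebra D hD d) := by
  let L : D →ₗ[ℝ] DualTraceSpace A := traceEval ∘ₗ (ofSubalgebraₗ D hD).restrictScalars ℝ
  change Continuous L
  refine continuous_of_continuousAt_zero L ?_
  rw [ContinuousAt, map_zero,
    (CompactConvergenceCLM.hasBasis_nhds_zero_of_basis Metric.nhds_basis_ball).tendsto_right_iff]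
  rintro ⟨K, ε⟩ ⟨hK, hε⟩
  obtain ⟨M, hM⟩ := exists_bound_of_isCompact hK D hc hD
  have hlim : Filter.Tendsto (fun d : D => M * ‖d‖) (𝓝 0) (𝓝 0) := by
    have h : Continuous fun d : D => M * ‖d‖ := by fun_prop
    simpa using h.tendsto 0
  filter_upwards [hlim.eventually_lt_const hε] with d hd τ hτ
  rw [mem_ball_zero_iff]
  exact ((Complex.abs_re_le_norm _).trans (hM τ hτ d)).trans_lt hd

/-! ### Reflexivity of the trace space -/

/-- The trace representing a functional on the dual of the trace space. -/
noncomputable def bidualTrace (g : BidualTraceSpace A) : TraceSpace A := by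
  let φ : PedersenIdeal A →ₗ[ℂ] ℂ :=
    Module.Dual.extendRCLike (𝕜 := ℂ) ((g : DualTraceSpace A →L[ℝ] ℝ).toLinearMap ∘ₗ traceEval)
  have hφ : ∀ x, φ x = (g (traceEval x) : ℂ) - Complex.I * g (traceEval (Complex.I • x)) :=
    fun x => Module.Dual.extendRCLike_apply _ x
  refine ⟨(⟨φ, continuous_of_forall_subalgebra φ fun D hc hD => ?_⟩ :
    PedersenIdeal A →L[ℂ] ℂ), fun x y => ?_, fun x => ?_⟩
  · simp only [hφ]
    have hg : Continuous g := (g : DualTraceSpace A →L[ℝ] ℝ).continuous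
    have h := hg.comp (continuous_traceEval_ofSubalgebra D hc hD)
    have hI : Continuous fun d : D => Complex.I • d := continuous_const_smul Complex.I
    exact (Complex.continuous_ofReal.comp h).sub
      (continuous_const.mul (Complex.continuous_ofReal.comp (h.comp hI)))
  · change φ (x * y) = φ (y * x)
    -- The term at `i(xy)` is handled by moving `i` onto `x`, swapping the factors, and pulling `i`
    -- out again.
    rw [hφ, hφ, traceEval_mul_comm x y, ← smul_mul_eq, traceEval_mul_comm _ y, mul_smul_eq]
  · change φ (star x) = star (φ x)
    -- The sign from conjugating `i` becomes the complex conjugation of `φ x`.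
    have h : Complex.I • star x = -star (Complex.I • x) := by
      rw [star_smul_eq, Complex.star_def, Complex.conj_I, neg_smul, neg_neg]
    rw [hφ, hφ, h, map_neg, map_neg, traceEval_star, traceEval_star]
    simp

/-- Every `f` is some `traceEval x`, and the real part of the complexified functional at `x` is the
original real one. -/
theorem apply_bidualTrace (g : BidualTraceSpace A) (f : DualTraceSpace A) :
    f (bidualTrace g) = g f := by
  obtain ⟨x, rfl⟩ := traceEval_surjective f
  change (Module.Dual.extendRCLike (𝕜 := ℂ)
    ((g : DualTraceSpace A →L[ℝ] ℝ).toLinearMap ∘ₗ traceEval) x).re = g (traceEval x)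
  rw [Module.Dual.extendRCLike_apply]
  simp
  rfl

theorem traceSpace_ext {σ τ : TraceSpace A} (h : ∀ f : DualTraceSpace A, f σ = f τ) : σ = τ := by
  refine Subtype.ext (ContinuousLinearMap.ext fun x => ?_)
  change σ.1 x = τ.1 x
  rw [trace_apply_eq, trace_apply_eq, h, h]

/-- The weak⋆ topology is also the weak topology defined by the dual; this yields continuity of both
the inverse isomorphism and the predual map. -/
theorem continuous_traceSpace_of_forall {X : Type*} [TopologicalSpace X] {u : X → TraceSpace A}
    (h : ∀ f : DualTraceSpace A, Continuous fun x => f (u x)) : Continuous u := by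
  refine continuous_induced_rng.2 (WeakDual.continuous_of_continuous_eval fun a => ?_)
  simp only [Function.comp_apply, trace_apply_eq]
  exact (Complex.continuous_ofReal.comp (h _)).sub
    (continuous_const.mul (Complex.continuous_ofReal.comp (h _)))

variable (A) in
/-- The canonical isomorphism of the trace space with the dual of its dual. -/
noncomputable def traceBidualEquiv : TraceSpace A ≃L[ℝ] BidualTraceSpace A where
  toFun τ := (⟨⟨⟨fun f => f τ, fun _ _ => rfl⟩, fun _ _ => rfl⟩,
    -- Points are compact, so evaluation at `τ` is continuous for the compact-open topology.
    continuous_eval_const τ⟩ : DualTraceSpace A →L[ℝ] ℝ)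
  map_add' σ τ := ContinuousLinearMap.ext fun f : DualTraceSpace A =>
    ContinuousLinearMap.map_add f σ τ
  map_smul' c τ := ContinuousLinearMap.ext fun f : DualTraceSpace A =>
    ContinuousLinearMap.map_smul f c τ
  invFun := bidualTrace
  left_inv _ := traceSpace_ext fun f => apply_bidualTrace _ f
  right_inv g := ContinuousLinearMap.ext fun f => apply_bidualTrace g f
  continuous_toFun := WeakDual.continuous_of_continuous_eval fun f : DualTraceSpace A =>
    ContinuousLinearMap.continuous f
  continuous_invFun := continuous_traceSpace_of_forall fun f =>
    (WeakDual.eval_continuous f).congr fun g => (apply_bidualTrace g f).symm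

/-- Evaluations at positive elements lie in the dual cone and already detect positivity, so no
separation theorem is needed. The imaginary part vanishes because positive elements are
self-adjoint. -/
theorem mem_traceCone_iff {τ : TraceSpace A} :
    τ ∈ traceCone A ↔ ∀ f ∈ dualTraceCone A, 0 ≤ f τ := by
  refine ⟨fun hτ f hf => hf τ hτ, fun h a ha => Complex.le_def.2 ⟨?_, ?_⟩⟩
  · exact h _ (traceEval_mem_dualTraceCone ha)
  · have hstar := τ.2.2 a
    rw [star_eq_of_nonneg ha] at hstar
    exact (Complex.conj_eq_iff_im.1 hstar.symm).symm

/-! ### Duals and preduals of maps between trace spaces -/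

variable {B : Type*} [NonUnitalCStarAlgebra B] [PartialOrder B] [StarOrderedRing B]

@[simp]
theorem dualMap_apply (γ : TraceSpace B →L[ℝ] TraceSpace A) (f : DualTraceSpace A)
    (τ : TraceSpace B) : dualMap γ f τ = f (γ τ) := rfl

/-- The trace on `A` representing the functional `f ↦ η(f)(τ)`. -/
noncomputable def predualTrace (η : DualTraceSpace A →L[ℝ] DualTraceSpace B) (τ : TraceSpace B) :
    TraceSpace A :=
  bidualTrace ((traceBidualEquiv B τ : DualTraceSpace B →L[ℝ] ℝ).comp η : DualTraceSpace A →L[ℝ] ℝ)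

theorem apply_predualTrace (η : DualTraceSpace A →L[ℝ] DualTraceSpace B) (f : DualTraceSpace A)
    (τ : TraceSpace B) : f (predualTrace η τ) = η f τ :=
  apply_bidualTrace (A := A) _ f

/-- The predual `T_ℝ(B) → T_ℝ(A)` of a continuous linear map `T_ℝ(A)^* → T_ℝ(B)^*`. -/
noncomputable def predualMap (η : DualTraceSpace A →L[ℝ] DualTraceSpace B) :
    TraceSpace B →L[ℝ] TraceSpace A where
  toFun := predualTrace η
  map_add' σ τ := traceSpace_ext fun f => by
    refine Eq.trans ?_ (ContinuousLinearMap.map_add f _ _).symm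
    refine Eq.trans ?_ (congrArg₂ (· + ·) (apply_predualTrace η f σ)
      (apply_predualTrace η f τ)).symm
    exact (apply_predualTrace η f _).trans (ContinuousLinearMap.map_add (η f) σ τ)
  map_smul' c τ := traceSpace_ext fun f => by
    refine Eq.trans ?_ (ContinuousLinearMap.map_smul f c _).symm
    refine Eq.trans ?_ (congrArg (c • ·) (apply_predualTrace η f τ)).symm
    exact (apply_predualTrace η f _).trans (ContinuousLinearMap.map_smul (η f) c τ)
  cont := continuous_traceSpace_of_forall fun f =>
    (ContinuousLinearMap.continuous (η f)).congr fun τ => (apply_predualTrace η f τ).symm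

theorem dualMap_bijective : Function.Bijective
    (dualMap : (TraceSpace B →L[ℝ] TraceSpace A) → (DualTraceSpace A →L[ℝ] DualTraceSpace B)) := by
  refine ⟨fun γ δ h => ContinuousLinearMap.ext fun τ => traceSpace_ext fun f => ?_, fun η =>
    ⟨predualMap η, ContinuousLinearMap.ext fun f => dualTraceSpace_ext (apply_predualTrace η f)⟩⟩
  rw [← dualMap_apply, h, dualMap_apply]

/-- The forward direction rests on the dual cone determining the cone of traces. -/
theorem dualMap_positive_iff (γ : TraceSpace B →L[ℝ] TraceSpace A) :
    (∀ f ∈ dualTraceCone A, dualMap γ f ∈ dualTraceCone B) ↔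
      ∀ τ ∈ traceCone B, γ τ ∈ traceCone A :=
  ⟨fun h τ hτ => mem_traceCone_iff.2 fun f hf => h f hf τ hτ,
    fun h _ hf τ hτ => hf _ (h τ hτ)⟩

end DualTraces

theorem proposition4p5 {A B : Type*}
    [NonUnitalCStarAlgebra A] [PartialOrder A] [StarOrderedRing A]
    [NonUnitalCStarAlgebra B] [PartialOrder B] [StarOrderedRing B] :
    -- the canonical map is an isomorphism of ordered topological vector spaces
    (∃ ω : TraceSpace A ≃L[ℝ] BidualTraceSpace A,
      (∀ (τ : TraceSpace A) (f : DualTraceSpace A), ω τ f = f τ) ∧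
      ∀ τ : TraceSpace A, τ ∈ traceCone A ↔ ω τ ∈ bidualTraceCone A) ∧
    -- taking duals is a bijection between continuous linear maps
    Function.Bijective
      (dualMap : (TraceSpace B →L[ℝ] TraceSpace A) → (DualTraceSpace A →L[ℝ] DualTraceSpace B)) ∧
    -- and it restricts to a bijection between continuous positive linear maps
    Set.BijOn
      (dualMap : (TraceSpace B →L[ℝ] TraceSpace A) → (DualTraceSpace A →L[ℝ] DualTraceSpace B))
      {γ | ∀ τ ∈ traceCone B, γ τ ∈ traceCone A}
      {η | ∀ f ∈ dualTraceCone A, η f ∈ dualTraceCone B} := by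
  refine ⟨⟨traceBidualEquiv A, fun _ _ => rfl, fun τ => mem_traceCone_iff⟩, dualMap_bijective,
    fun γ hγ => (dualMap_positive_iff γ).2 hγ, dualMap_bijective.1.injOn, fun η hη => ?_⟩
  obtain ⟨γ, rfl⟩ := dualMap_bijective.2 η
  exact ⟨γ, (dualMap_positive_iff γ).1 hη, rfl⟩
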